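/- **Setting.** There are $K$ arms. In round $t\ge 1$ the learner selects an arm $a_t\in[K]$ (possibly at random, depending on the past observations) and observes a reward $r_t\sim\mathcal N(\theta_{a_t},1)$, conditionally independent of the past given $a_t$. Let $\Theta$ be the set of $\theta\in\mathbb R^K$ whose maximal entry is attained by exactly one arm $a^\star=a^\star(\theta)$, and let $\Delta_a=\theta_{a^\star}-\theta_a$. With $\mathcal F_t=\sigma(a_1,r_1,\dots,a_t,r_t)$, an algorithm consists of a sampling rule, a stopping time $\tau_\delta$ with respect to $(\mathcal F_t)$, and an $\mathcal F_{\tau_\delta}$-measurable guess $\hat a_{\tau_\delta}\in[K]$. Write $N_a(t)$ for the number of selections of arm $a$ in the first $t$ rounds. The algorithm is $\delta$-PAC if $\mathbb P_\theta(\hat a_{\tau_\delta}\ne a^\star)\le\delta$ and $\mathbb P_\theta(\tau_\delta<\infty)=1$ for all $\theta\in\Theta$. For a rate vector $p\in[0,1]^K$ with $\sum_a p_a\le 1$, let $\Sigma_p=\{w\in[0,1]^K:\ \sum_a w_a=1,\ w_a\ge p_a\ \forall a\}$ and $$T^\star_p=T^\star_p(\theta)=2\inf_{w\in\Sigma_p}\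 \max_{a\ne a^\star}\frac{w_a^{-1}+w_{a^\star}^{-1}}{\Delta_a^2}\in[0,\infty]\qquad(1/0=\infty).$$ **Theorem.** (1) Let $p\in[0,1]^K$ with $\sum_a p_a\le 1$, let $\delta\in(0,1/2)$, and consider a $\delta$-PAC algorithm that is $p$-fair, i.e. $\mathbb E_\theta[N_a(\tau_\delta)]/\mathbb E_\theta[\tau_\delta]\ge p_a$ for all $a\in[K]$ and all $\theta\in\Theta$ (no constraint if $\mathbb E_\theta[\tau_\delta]=\infty$). Then for all $\theta\in\Theta$, $$\mathbb E_\theta[\tau_\delta]\ \ge\ T^\star_p(\theta)\,\max\Bigl(0,\log\frac1{2.4\,\delta}\Bigr)\qquad(\infty\cdot 0=0);$$ in particular $\mathbb E_\theta[\tau_\delta]/\log(1/(2.4\,\delta))\ge T^\star_p(\theta)$ whenever $\delta<1/2.4$. (2) Let $p=(p_a)_{a\in[K]}$ be functions of $\theta\in\Theta$ with $p_a(\theta)\ge 0$ and $\sum_a p_a(\theta)\le1$, and consider a family of algorithms indexed by $\delta$ that is asymptotically $p(\theta)$-fair and $\delta$-PAC, i.e. it is $\delta$-PAC for every $\delta\in(0,1/2)$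 and $\liminf_{\delta\to0}\mathbb E_\theta[N_a(\tau_\delta)]/\mathbb E_\theta[\tau_\delta]\ge p_a(\theta)$ for all $a\in[K]$ and all $\theta\in\Theta$ (values of $\delta$ with $\mathbb E_\theta[\tau_\delta]=\infty$ impose no constraint). Then for all $\theta\in\Theta$, $$\liminf_{\delta\to0}\frac{\mathbb E_\theta[\tau_\delta]}{\log(1/\delta)}\ \ge\ T^\star_{p(\theta)}(\theta).$$ -/

import Mathlib

open MeasureTheory ProbabilityTheory Filter Topology
open scoped ENNReal

namespace FairBAI

/-- A trajectory of the bandit problem with `K` arms. Round `t + 1` is stored at index `t`: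
`ω t = (a_{t+1}, r_{t+1})` is the arm selected in that round and the reward observed. -/
abbrev Trajectory (K : ℕ) : Type := ℕ → Fin K × ℝ

/-- The filtration of observations: the `t`-th σ-algebra is generated by the first `t` rounds
`(a_1, r_1, …, a_t, r_t)`; it is trivial for `t = 0`. -/
def history (K : ℕ) : Filtration ℕ (inferInstance : MeasurableSpace (Trajectory K)) where
  seq t := MeasurableSpace.comap (fun (ω : Trajectory K) (i : Fin t) => ω i) inferInstance
  mono' := by
    intro s t hst
    have h : (fun (ω : Trajectory K) (i : Fin s) => ω i) =
        (fun (x : Fin t → Fin K × ℝ) (i : Fin s) => x (Fin.castLE hst i)) ∘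
          (fun (ω : Trajectory K) (i : Fin t) => ω i) := rfl
    change MeasurableSpace.comap _ _ ≤ MeasurableSpace.comap _ _
    rw [h, ← MeasurableSpace.comap_comp]
    exact MeasurableSpace.comap_mono (Measurable.comap_le (by fun_prop))
  le' := fun t => Measurable.comap_le (by fun_prop)

/-- A best-arm-identification algorithm with `K` arms: a sampling rule, a stopping rule and a
decision rule. The sampling rule may be randomized: given the past observations it provides the
probability distribution of the next arm (rules for which the next arm is a measurable function of
the past are those whose distributions are Dirac masses). -/
structure BAIAlgorithm (K : ℕ) where
  /-- distribution of the first arm -/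
  firstArm : Measure (Fin K)
  isProbability_firstArm : IsProbabilityMeasure firstArm
  /-- distribution of the arm selected at index `n + 1`, given the rounds of index `0, …, n` -/
  nextArm : (n : ℕ) → Kernel (Finset.Iic n → Fin K × ℝ) (Fin K)
  isMarkov_nextArm : ∀ n, IsMarkovKernel (nextArm n)
  /-- number of rounds after which the algorithm stops (`⊤` if it never stops) -/
  τ : Trajectory K → ℕ∞
  isStoppingTime_τ : IsStoppingTime (history K) τ
  /-- the arm that is returned; it depends only on the observations up to the stopping time -/
  guess : Trajectory K → Fin K
  measurable_guess : Measurable[isStoppingTime_τ.measurableSpace] guess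

attribute [instance] BAIAlgorithm.isProbability_firstArm BAIAlgorithm.isMarkov_nextArm

/-- The reward of arm `a` in model `θ` has law `N(θ a, 1)`. -/
noncomputable def reward {K : ℕ} (θ : Fin K → ℝ) : Kernel (Fin K) ℝ where
  toFun a := gaussianReal (θ a) 1
  measurable' := measurable_of_countable _

instance {K : ℕ} (θ : Fin K → ℝ) : IsMarkovKernel (reward θ) :=
  ⟨fun a => inferInstanceAs (IsProbabilityMeasure (gaussianReal (θ a) 1))⟩

namespace BAIAlgorithm

variable {K : ℕ}

/-- The conditional law of the round of index `n + 1` given the earlier rounds: an arm is drawn by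
the sampling rule, then a reward is drawn from the law of that arm. -/
noncomputable def roundKernel (A : BAIAlgorithm K) (θ : Fin K → ℝ) (n : ℕ) :
    Kernel (Finset.Iic n → Fin K × ℝ) (Fin K × ℝ) :=
  A.nextArm n ⊗ₖ Kernel.prodMkLeft (Finset.Iic n → Fin K × ℝ) (reward θ)

instance (A : BAIAlgorithm K) (θ : Fin K → ℝ) (n : ℕ) : IsMarkovKernel (A.roundKernel θ n) := by
  unfold roundKernel
  infer_instance

/-- `ℙ_θ`: the law of the trajectory when the algorithm samples in the model `θ`
(if sampling is continued for ever; only the rounds up to `τ` matter below). -/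
noncomputable def law (A : BAIAlgorithm K) (θ : Fin K → ℝ) : Measure (Trajectory K) :=
  Kernel.trajMeasure (X := fun _ => Fin K × ℝ) (A.firstArm ⊗ₘ reward θ) (A.roundKernel θ)

/-- `N_a(τ)`: the number of rounds up to the stopping time in which arm `a` is selected. -/
noncomputable def visits (A : BAIAlgorithm K) (a : Fin K) (ω : Trajectory K) : ℝ≥0∞ :=
  open Classical in ∑' t : ℕ, if (t : ℕ∞) < A.τ ω ∧ (ω t).1 = a then 1 else 0

/-- `𝔼_θ[N_a(τ)]` -/
noncomputable def expVisits (A : BAIAlgorithm K) (θ : Fin K → ℝ) (a : Fin K) : ℝ≥0∞ :=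
  ∫⁻ ω, A.visits a ω ∂(A.law θ)

/-- The sample complexity `𝔼_θ[τ]`, possibly infinite. -/
noncomputable def sampleComplexity (A : BAIAlgorithm K) (θ : Fin K → ℝ) : ℝ≥0∞ :=
  ∫⁻ ω, ((A.τ ω : ℕ∞) : ℝ≥0∞) ∂(A.law θ)

/-- The selection rate `𝔼_θ[N_a(τ)] / 𝔼_θ[τ]`. The quotient has no meaning if `𝔼_θ[τ] = ∞`; the
value `1` chosen there makes a fairness constraint (a lower bound at most `1`) void. -/
noncomputable def selectionRate (A : BAIAlgorithm K) (θ : Fin K → ℝ) (a : Fin K) : ℝ≥0∞ :=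
  open Classical in
  if A.sampleComplexity θ = ⊤ then 1 else A.expVisits θ a / A.sampleComplexity θ

end BAIAlgorithm

/-- `a` is the unique best arm of the model `θ`. The set `Θ` of models of interest consists of all
`θ` that have a unique best arm. -/
def IsUniqueBestArm {K : ℕ} (θ : Fin K → ℝ) (a : Fin K) : Prop :=
  ∀ b, b ≠ a → θ b < θ a

/-- Vectors of fairness rates: nonnegative entries, with sum at most `1`. -/
def IsFairnessRate {K : ℕ} (p : Fin K → ℝ) : Prop :=
  (∀ a, 0 ≤ p a) ∧ ∑ a, p a ≤ 1

/-- `δ`-PAC: for every `θ ∈ Θ`, the algorithm stops almost surely and returns a wrong arm with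
probability at most `δ`. -/
def IsPAC {K : ℕ} (δ : ℝ) (A : BAIAlgorithm K) : Prop :=
  ∀ (θ : Fin K → ℝ) (astar : Fin K), IsUniqueBestArm θ astar →
    A.law θ {ω | A.guess ω ≠ astar} ≤ ENNReal.ofReal δ ∧ A.law θ {ω | A.τ ω < ⊤} = 1

/-- `p`-fair `δ`-PAC algorithms, for pre-specified rates `p`. -/
def IsFairPAC {K : ℕ} (p : Fin K → ℝ) (δ : ℝ) (A : BAIAlgorithm K) : Prop :=
  IsPAC δ A ∧
  ∀ (θ : Fin K → ℝ) (astar : Fin K), IsUniqueBestArm θ astar →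
    ∀ a, ENNReal.ofReal (p a) ≤ A.selectionRate θ a

/-- Asymptotically `p(θ)`-fair `δ`-PAC algorithms, that is, families indexed by the confidence
parameter `δ`. -/
def IsAsympFairPAC {K : ℕ} (p : (Fin K → ℝ) → Fin K → ℝ) (A : ℝ → BAIAlgorithm K) : Prop :=
  (∀ δ ∈ Set.Ioo (0 : ℝ) (1 / 2), IsPAC δ (A δ)) ∧
  ∀ (θ : Fin K → ℝ) (astar : Fin K), IsUniqueBestArm θ astar →
    ∀ a, ENNReal.ofReal (p θ a) ≤ liminf (fun δ => (A δ).selectionRate θ a) (𝓝[>] (0 : ℝ))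

/-- The clipped simplex `Σ_p`. -/
def clippedSimplex {K : ℕ} (p : Fin K → ℝ) : Set (Fin K → ℝ) :=
  {w | w ∈ stdSimplex ℝ (Fin K) ∧ ∀ a, p a ≤ w a}

/-- The characteristic time `T*_p` of the model `θ` with best arm `astar`:
`2 inf_{w ∈ Σ_p} max_{a ≠ astar} (1 / w_a + 1 / w_astar) / Δ_a ^ 2`, with `1 / 0 = ∞`. -/
noncomputable def charTime {K : ℕ} (θ : Fin K → ℝ) (astar : Fin K) (p : Fin K → ℝ) : ℝ≥0∞ :=
  2 * ⨅ w ∈ clippedSimplex p, ⨆ a, ⨆ _ : a ≠ astar,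
    ((ENNReal.ofReal (w a))⁻¹ + (ENNReal.ofReal (w astar))⁻¹) /
      ENNReal.ofReal ((θ astar - θ a) ^ 2)

end FairBAI

/-! Fix `θ` with best arm `a` and finite expected stopping time. If `ν` has another best arm, the
event that `a` is returned has probability at least `1 - δ` under `θ` and at most `δ` under `ν`. The
sampling rule is the same in both models, so on observations up to `τ` the likelihood ratio is the
product of the Gaussian reward ratios, and the expected information is at most `∑ c, 𝔼_θ[N_c] (ν c -
θ c)² / 2` (`integral_stoppedLogLR_ge`). The Donsker–Varadhan bound for the indicator of that event
(`transportation`) shows that this sum is at least `kl(δ, 1 - δ)` (`IsPAC.binary_kl_le`), which is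
at least `log (1 / (2.4 δ))`.

By continuity `ν` may lie on the boundary of the alternatives. Moving only `a` and one rival `c` to
their weighted mean is the cheapest such choice and produces the harmonic expression `1 / N_c + 1 /
N_a` (`harmonic_bound`). Dividing by `𝔼_θ[τ]` turns the expected counts into a point `w` of the
simplex, and fairness says precisely that `w ∈ Σ_p`; this is part (1).

In part (2) the point `w` depends on `δ` and is fair only in the limit. Compactness of the simplex
gives a limit point, which lies in `Σ_p`, and the objective passes to the limit by continuity in
`ℝ≥0∞`. -/

namespace FairBAI

variable {K : ℕ}

/-! ### Finite histories and the conditional law of a round. -/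

/-- The first `n` rounds of a trajectory. -/
def firstRounds (n : ℕ) (ω : Trajectory K) : Fin n → Fin K × ℝ := fun i => ω i

@[fun_prop]
lemma measurable_firstRounds (n : ℕ) : Measurable (firstRounds n : Trajectory K → _) := by
  unfold firstRounds
  fun_prop

lemma firstRounds_succ (n : ℕ) (ω : Trajectory K) :
    firstRounds (n + 1) ω = Fin.snoc (α := fun _ => Fin K × ℝ) (firstRounds n ω) (ω n) := by
  ext1 i
  refine Fin.lastCases ?_ (fun j => ?_) i <;> simp [firstRounds]

lemma measurable_snoc (n : ℕ) :
    Measurable (fun x : (Fin n → Fin K × ℝ) × (Fin K × ℝ) =>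
      Fin.snoc (α := fun _ => Fin K × ℝ) x.1 x.2) := by
  refine measurable_pi_lambda _ fun i => ?_
  refine Fin.lastCases ?_ (fun j => ?_) i
  · simpa using measurable_snd
  · simpa [Function.comp_def] using (measurable_pi_apply j).comp measurable_fst

namespace BAIAlgorithm

instance (A : BAIAlgorithm K) (θ : Fin K → ℝ) : IsProbabilityMeasure (A.law θ) := by
  unfold law
  infer_instance

/-- The distribution of the arm selected at index `n`, given the first `n` rounds. -/
noncomputable def armKernel (A : BAIAlgorithm K) : (n : ℕ) → Kernel (Fin n → Fin K × ℝ) (Fin K)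
  | 0 => Kernel.const _ A.firstArm
  | n + 1 => (A.nextArm n).comap
      (fun x i => x ⟨i, Nat.lt_succ_of_le (Finset.mem_Iic.1 i.2)⟩) (by fun_prop)

instance (A : BAIAlgorithm K) (n : ℕ) : IsMarkovKernel (A.armKernel n) := by
  cases n <;> (unfold armKernel; infer_instance)

lemma map_eval_zero_law (A : BAIAlgorithm K) (θ : Fin K → ℝ) :
    (A.law θ).map (fun ω => ω 0) = A.firstArm ⊗ₘ reward θ := by
  have h : (A.law θ).map (Preorder.frestrictLe 0) =
      (A.firstArm ⊗ₘ reward θ).map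
        (MeasurableEquiv.piUnique (fun _ : Finset.Iic 0 => Fin K × ℝ)).symm := by
    rw [law, Kernel.trajMeasure, Measure.map_comp _ _ (by fun_prop), Kernel.traj_map_frestrictLe,
      Kernel.partialTraj_self]
    exact Measure.id_comp
  have h2 : (fun ω : Trajectory K => ω 0) =
      (MeasurableEquiv.piUnique (fun _ : Finset.Iic 0 => Fin K × ℝ)) ∘
        (Preorder.frestrictLe (π := fun _ => Fin K × ℝ) 0) := rfl
  rw [h2, ← Measure.map_map (MeasurableEquiv.measurable _) (by fun_prop), h,
    Measure.map_map (MeasurableEquiv.measurable _) (MeasurableEquiv.measurable _),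
    MeasurableEquiv.self_comp_symm, Measure.map_id]

/-- The reward of a round has law `reward θ` given its arm and the past, and the arm is drawn
from `armKernel`. -/
lemma lintegral_round (A : BAIAlgorithm K) (θ : Fin K → ℝ) (n : ℕ)
    {f : (Fin n → Fin K × ℝ) × (Fin K × ℝ) → ℝ≥0∞} (hf : Measurable f) :
    ∫⁻ ω, f (firstRounds n ω, ω n) ∂A.law θ =
      ∫⁻ ω, ∫⁻ a, ∫⁻ r, f (firstRounds n ω, (a, r)) ∂reward θ a
        ∂A.armKernel n (firstRounds n ω) ∂A.law θ := by
  cases n with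
  | zero =>
    have h0 : ∀ ω : Trajectory K, firstRounds 0 ω = default := fun ω => Subsingleton.elim _ _
    simp only [h0, armKernel, Kernel.const_apply, lintegral_const, measure_univ, mul_one]
    rw [← lintegral_map (f := fun y => f (default, y)) (by fun_prop) (by fun_prop),
      map_eval_zero_law, Measure.lintegral_compProd (by fun_prop)]
  | succ n =>
    let e : (Finset.Iic n → Fin K × ℝ) → Fin (n + 1) → Fin K × ℝ :=
      fun x i => x ⟨i, Finset.mem_Iic.2 (Nat.le_of_lt_succ i.2)⟩
    have he : Measurable e := by fun_prop
    have hfr : ∀ ω : Trajectory K, firstRounds (n + 1) ω =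
        e (Preorder.frestrictLe (π := fun _ => Fin K × ℝ) n ω) := fun ω => rfl
    have hmap := Kernel.map_frestrictLe_trajMeasure_compProd_eq_map_trajMeasure
      (X := fun _ => Fin K × ℝ) (μ₀ := A.firstArm ⊗ₘ reward θ) (κ := A.roundKernel θ) (a := n)
    have h1 : ∫⁻ ω, f (firstRounds (n + 1) ω, ω (n + 1)) ∂A.law θ =
        ∫⁻ z, f (e z.1, z.2) ∂((A.law θ).map (fun ω =>
          (Preorder.frestrictLe (π := fun _ => Fin K × ℝ) n ω, ω (n + 1)))) := by
      rw [lintegral_map (by fun_prop) (by fun_prop)]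
      simp only [hfr]
    rw [h1, law, ← hmap, Measure.lintegral_compProd (by fun_prop),
      lintegral_map (Measurable.lintegral_kernel_prod_right' (f := fun z => f (e z.1, z.2))
        (by fun_prop)) (by fun_prop)]
    refine lintegral_congr fun ω => ?_
    rw [roundKernel, Kernel.lintegral_compProd _ _ _ (by fun_prop)]
    rfl

end BAIAlgorithm

/-! ### Change of measure, at fixed times and at the stopping time. -/

/-- The log-likelihood ratio of the models `ν` and `θ` for one round. -/
noncomputable def logLR (θ ν : Fin K → ℝ) (x : Fin K × ℝ) : ℝ :=
  (ν x.1 - θ x.1) * (x.2 - θ x.1) - (ν x.1 - θ x.1) ^ 2 / 2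

@[fun_prop]
lemma measurable_logLR (θ ν : Fin K → ℝ) : Measurable (logLR θ ν) := by
  have h (g : Fin K → ℝ) : Measurable fun x : Fin K × ℝ => g x.1 :=
    (measurable_of_countable g).comp measurable_fst
  unfold logLR
  have h1 := h ν
  have h2 := h θ
  fun_prop

lemma lintegral_reward_change (θ ν : Fin K → ℝ) (a : Fin K) {f : ℝ → ℝ≥0∞} (hf : Measurable f) :
    ∫⁻ r, f r ∂reward ν a = ∫⁻ r, f r * ENNReal.ofReal (Real.exp (logLR θ ν (a, r)))
      ∂reward θ a := by
  change ∫⁻ r, f r ∂gaussianReal (ν a) 1 = ∫⁻ r, _ ∂gaussianReal (θ a) 1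
  rw [gaussianReal_of_var_ne_zero _ one_ne_zero, gaussianReal_of_var_ne_zero _ one_ne_zero,
    lintegral_withDensity_eq_lintegral_mul _ (measurable_gaussianPDF _ _) hf,
    lintegral_withDensity_eq_lintegral_mul _ (measurable_gaussianPDF _ _) (by fun_prop)]
  refine lintegral_congr fun r => ?_
  have h : gaussianPDF (ν a) 1 r =
      gaussianPDF (θ a) 1 r * ENNReal.ofReal (Real.exp (logLR θ ν (a, r))) := by
    rw [gaussianPDF, gaussianPDF, ← ENNReal.ofReal_mul (gaussianPDFReal_nonneg _ _ _)]
    congr 1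
    simp only [gaussianPDFReal, logLR, mul_assoc, ← Real.exp_add]
    congr 2
    simp
    ring
  simp only [Pi.mul_apply, h]
  ring

namespace BAIAlgorithm

/-- Induction on the rounds: the arm is drawn from the same kernel in both models, so each round
contributes only the ratio of the reward densities. -/
lemma lintegral_law_change (A : BAIAlgorithm K) (θ ν : Fin K → ℝ) (n : ℕ)
    {f : (Fin n → Fin K × ℝ) → ℝ≥0∞} (hf : Measurable f) :
    ∫⁻ ω, f (firstRounds n ω) ∂A.law ν =
      ∫⁻ ω, f (firstRounds n ω) *
        ∏ i, ENNReal.ofReal (Real.exp (logLR θ ν (firstRounds n ω i))) ∂A.law θ := by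
  induction n with
  | zero =>
    have h0 : ∀ ω : Trajectory K, firstRounds 0 ω = default := fun ω => Subsingleton.elim _ _
    simp [h0]
  | succ n ih =>
    have hs := measurable_snoc (K := K) n
    have hf' : Measurable fun z : (Fin n → Fin K × ℝ) × (Fin K × ℝ) =>
      f (Fin.snoc (α := fun _ => Fin K × ℝ) z.1 z.2) := hf.comp hs
    simp only [firstRounds_succ, Fin.prod_univ_castSucc, Fin.snoc_castSucc, Fin.snoc_last]
    rw [A.lintegral_round ν n (f := fun z => f (Fin.snoc (α := fun _ => Fin K × ℝ) z.1 z.2)) hf',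
      A.lintegral_round θ n (f := fun z => f (Fin.snoc (α := fun _ => Fin K × ℝ) z.1 z.2) *
        ((∏ i, ENNReal.ofReal (Real.exp (logLR θ ν (z.1 i)))) *
          ENNReal.ofReal (Real.exp (logLR θ ν z.2)))) (by fun_prop)]
    simp only
    have hm : Measurable fun z : ((Fin n → Fin K × ℝ) × Fin K) × ℝ =>
        f (Fin.snoc (α := fun _ => Fin K × ℝ) z.1.1 (z.1.2, z.2)) :=
      hf'.comp (f := fun z : ((Fin n → Fin K × ℝ) × Fin K) × ℝ => (z.1.1, (z.1.2, z.2)))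
        (by fun_prop)
    have hm2 : Measurable fun z : (Fin n → Fin K × ℝ) × Fin K =>
        ∫⁻ r, f (Fin.snoc (α := fun _ => Fin K × ℝ) z.1 (z.2, r)) ∂reward ν z.2 :=
      Measurable.lintegral_kernel_prod_right' (κ := Kernel.prodMkLeft _ (reward ν)) hm
    have hm3 : Measurable fun x : Fin n → Fin K × ℝ => ∫⁻ a,
        ∫⁻ r, f (Fin.snoc (α := fun _ => Fin K × ℝ) x (a, r)) ∂reward ν a ∂A.armKernel n x :=
      Measurable.lintegral_kernel_prod_right' hm2
    rw [ih hm3]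
    refine lintegral_congr fun ω => ?_
    rw [← lintegral_mul_const _ (measurable_of_countable _)]
    refine lintegral_congr fun a => ?_
    have hm4 : Measurable fun r =>
        f (Fin.snoc (α := fun _ => Fin K × ℝ) (firstRounds n ω) (a, r)) :=
      hm.comp (f := fun r : ℝ => ((firstRounds n ω, a), r)) (by fun_prop)
    rw [lintegral_reward_change θ ν a hm4, ← lintegral_mul_const _ (by fun_prop)]
    refine lintegral_congr fun r => ?_
    ring

lemma law_change_apply (A : BAIAlgorithm K) (θ ν : Fin K → ℝ) (n : ℕ) {s : Set (Trajectory K)}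
    (hs : MeasurableSet[history K n] s) :
    A.law ν s = ∫⁻ ω in s, ENNReal.ofReal (Real.exp (∑ t ∈ Finset.range n, logLR θ ν (ω t)))
      ∂A.law θ := by
  obtain ⟨u, hu, rfl⟩ := hs
  change A.law ν (firstRounds n ⁻¹' u) = ∫⁻ ω in firstRounds n ⁻¹' u, _ ∂A.law θ
  have hmu : MeasurableSet (firstRounds n ⁻¹' u : Set (Trajectory K)) :=
    measurable_firstRounds n hu
  rw [← lintegral_indicator_one hmu, ← lintegral_indicator hmu]
  have := A.lintegral_law_change θ ν n (f := u.indicator 1) (measurable_one.indicator hu)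
  refine (Eq.trans ?_ this).trans ?_
  · rfl
  · refine lintegral_congr fun ω => ?_
    by_cases h : firstRounds n ω ∈ u
    · have h' : ω ∈ firstRounds n ⁻¹' u := h
      rw [Set.indicator_of_mem h, Set.indicator_of_mem h', Real.exp_sum,
        ENNReal.ofReal_prod_of_nonneg (fun _ _ => (Real.exp_pos _).le), Pi.one_apply, one_mul,
        ← Fin.prod_univ_eq_prod_range (fun t => ENNReal.ofReal (Real.exp (logLR θ ν (ω t))))]
      rfl
    · have h' : ω ∉ firstRounds n ⁻¹' u := h
      simp [h, h']

open Classical in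
/-- The log-likelihood ratio of the models `ν` and `θ` for the rounds of index less than `n` that
precede the stopping time. -/
noncomputable def stoppedLogLR (A : BAIAlgorithm K) (θ ν : Fin K → ℝ) (n : ℕ) (ω : Trajectory K) :
    ℝ :=
  ∑ t ∈ Finset.range n, if (t : ℕ∞) < A.τ ω then logLR θ ν (ω t) else 0

lemma measurableSet_le (A : BAIAlgorithm K) (n : ℕ) :
    MeasurableSet[history K n] {ω | A.τ ω ≤ n} := A.isStoppingTime_τ n

lemma measurableSet_lt (A : BAIAlgorithm K) (n : ℕ) :
    MeasurableSet[history K n] {ω | (n : ℕ∞) < A.τ ω} := by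
  have := (A.measurableSet_le n).compl
  convert! this using 1
  ext ω
  simp

lemma measurable_stoppedLogLR (A : BAIAlgorithm K) (θ ν : Fin K → ℝ) (n : ℕ) :
    Measurable (A.stoppedLogLR θ ν n) := by
  unfold stoppedLogLR
  refine Finset.measurable_sum _ fun t _ => Measurable.ite ?_ (by fun_prop) measurable_const
  exact (history K).le t _ (A.measurableSet_lt t)

lemma stoppedLogLR_of_le (A : BAIAlgorithm K) (θ ν : Fin K → ℝ) {n : ℕ} {ω : Trajectory K}
    (h : (n : ℕ∞) ≤ A.τ ω) :
    A.stoppedLogLR θ ν n ω = ∑ t ∈ Finset.range n, logLR θ ν (ω t) := by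
  refine Finset.sum_congr rfl fun t ht => if_pos (lt_of_lt_of_le ?_ h)
  exact_mod_cast Finset.mem_range.1 ht

/-- Split `{τ ≤ n}` by the value `k` of `τ`. On `{τ = k}` the event is determined by `k` rounds, and
the stopped ratio is the ratio of those rounds. -/
lemma law_change_stopped (A : BAIAlgorithm K) (θ ν : Fin K → ℝ) (n : ℕ) {s : Set (Trajectory K)}
    (hs : MeasurableSet[A.isStoppingTime_τ.measurableSpace] s) :
    A.law ν (s ∩ {ω | A.τ ω ≤ n}) =
      ∫⁻ ω in s ∩ {ω | A.τ ω ≤ n}, ENNReal.ofReal (Real.exp (A.stoppedLogLR θ ν n ω))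
        ∂A.law θ := by
  have hs' : ∀ k : ℕ, MeasurableSet[history K k] (s ∩ {ω | A.τ ω ≤ k}) := hs.2
  have key : ∀ k : ℕ, MeasurableSet[history K k] (s ∩ {ω | A.τ ω = k}) := fun k => by
    have h1 : MeasurableSet[history K k] {ω | A.τ ω = k} := A.isStoppingTime_τ.measurableSet_eq k
    have := (hs' k).inter h1
    convert! this using 1
    ext ω
    simp only [Set.mem_inter_iff, Set.mem_ofPred_eq]
    constructor
    · rintro ⟨h, h'⟩
      exact ⟨⟨h, h'.le⟩, h'⟩
    · rintro ⟨⟨h, -⟩, h'⟩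
      exact ⟨h, h'⟩
  have keyeq : ∀ k : ℕ, A.law ν (s ∩ {ω | A.τ ω = k}) =
      ∫⁻ ω in s ∩ {ω | A.τ ω = k}, ENNReal.ofReal (Real.exp (A.stoppedLogLR θ ν k ω))
        ∂A.law θ := fun k => by
    rw [A.law_change_apply θ ν k (key k)]
    refine setLIntegral_congr_fun ((history K).le k _ (key k)) fun ω hω => ?_
    have : A.τ ω = k := hω.2
    rw [stoppedLogLR_of_le A θ ν this.ge]
  induction n with
  | zero =>
    have : {ω | A.τ ω ≤ (0 : ℕ)} = {ω | A.τ ω = (0 : ℕ)} := by ext; simp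
    rw [this]
    exact keyeq 0
  | succ n ih =>
    have hsplit : s ∩ {ω | A.τ ω ≤ (n + 1 : ℕ)} =
        (s ∩ {ω | A.τ ω ≤ n}) ∪ (s ∩ {ω | A.τ ω = (n + 1 : ℕ)}) := by
      rw [← Set.inter_union_distrib_left]
      congr 1
      ext ω
      simp only [Set.mem_union, Set.mem_ofPred_eq]
      cases A.τ ω with
      | top => simpa using (ENat.natCast_ne_top (n + 1)).symm
      | coe m => norm_cast; omega
    have hd : Disjoint (s ∩ {ω | A.τ ω ≤ n}) (s ∩ {ω | A.τ ω = (n + 1 : ℕ)}) := by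
      rw [Set.disjoint_left]
      rintro ω ⟨-, h⟩ ⟨-, h'⟩
      simp only [Set.mem_ofPred_eq] at h h'
      rw [h'] at h
      norm_cast at h
      omega
    have hm := (history K).le _ _ (key (n + 1))
    rw [hsplit, measure_union hd hm, lintegral_union hm hd, ih, keyeq]
    congr 1
    refine setLIntegral_congr_fun ((history K).le n _ (hs' n)) fun ω hω => ?_
    have hω' : A.τ ω ≤ n := hω.2
    have : A.stoppedLogLR θ ν (n + 1) ω = A.stoppedLogLR θ ν n ω := by
      rw [stoppedLogLR, Finset.sum_range_succ, if_neg hω'.not_gt, add_zero, stoppedLogLR]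
    rw [this]

/-- The stopped ratio is a density on `{τ ≤ n}`, the `n`-round ratio is one on the complement, and
the two pieces add up to the total mass of the law of `ν`. -/
lemma lintegral_exp_stoppedLogLR (A : BAIAlgorithm K) (θ ν : Fin K → ℝ) (n : ℕ) :
    ∫⁻ ω, ENNReal.ofReal (Real.exp (A.stoppedLogLR θ ν n ω)) ∂A.law θ = 1 := by
  have hm := (history K).le _ _ (A.measurableSet_le n)
  have h1 := A.law_change_stopped θ ν n (s := Set.univ) MeasurableSet.univ
  rw [Set.univ_inter] at h1
  have h2 := A.law_change_apply θ ν n (A.measurableSet_le n).compl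
  rw [← lintegral_add_compl _ hm, ← h1, ← prob_add_prob_compl (μ := A.law ν) hm, h2]
  congr 1
  refine setLIntegral_congr_fun hm.compl fun ω hω => ?_
  have hω' : ¬ A.τ ω ≤ n := hω
  rw [stoppedLogLR_of_le A θ ν (not_le.1 hω').le]

/-! ### Wald's identity and the transportation inequality. -/

lemma map_law_reward (A : BAIAlgorithm K) (θ : Fin K → ℝ) (n : ℕ) :
    (A.law θ).map (fun ω => ((firstRounds n ω, (ω n).1), (ω n).2)) =
      (A.law θ).map (fun ω => (firstRounds n ω, (ω n).1)) ⊗ₘ Kernel.prodMkLeft _ (reward θ) := by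
  refine Measure.ext_of_lintegral _ fun f hf => ?_
  have h2 : Measurable fun z : (Fin n → Fin K × ℝ) × Fin K => ∫⁻ r, f (z, r) ∂reward θ z.2 :=
    Measurable.lintegral_kernel_prod_right' (κ := Kernel.prodMkLeft _ (reward θ)) hf
  rw [lintegral_map hf (by fun_prop), Measure.lintegral_compProd hf]
  simp only [Kernel.prodMkLeft_apply]
  rw [lintegral_map h2 (by fun_prop),
    A.lintegral_round θ n (f := fun z => f ((z.1, z.2.1), z.2.2)) (by fun_prop),
    A.lintegral_round θ n (f := fun z => ∫⁻ r, f ((z.1, z.2.1), r) ∂reward θ z.2.1)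
      (h2.comp (f := fun z : (Fin n → Fin K × ℝ) × (Fin K × ℝ) => (z.1, z.2.1)) (by fun_prop))]
  simp

lemma integrable_logLR_reward (θ ν : Fin K → ℝ) (a : Fin K) :
    Integrable (fun r => logLR θ ν (a, r)) (reward θ a) := by
  have : Integrable (fun r : ℝ => r) (gaussianReal (θ a) 1) :=
    (memLp_id_gaussianReal 1).integrable le_rfl
  have h1 : Integrable (fun r : ℝ => r - θ a) (gaussianReal (θ a) 1) :=
    this.sub (integrable_const _)
  exact (h1.const_mul (ν a - θ a)).sub (integrable_const ((ν a - θ a) ^ 2 / 2))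

lemma integral_logLR_reward (θ ν : Fin K → ℝ) (a : Fin K) :
    ∫ r, logLR θ ν (a, r) ∂reward θ a = -((ν a - θ a) ^ 2 / 2) := by
  have h : Integrable (fun r : ℝ => r) (gaussianReal (θ a) 1) :=
    (memLp_id_gaussianReal 1).integrable le_rfl
  have h1 : Integrable (fun r : ℝ => r - θ a) (gaussianReal (θ a) 1) :=
    h.sub (integrable_const _)
  change ∫ r, (ν a - θ a) * (r - θ a) - (ν a - θ a) ^ 2 / 2 ∂gaussianReal (θ a) 1 = _
  rw [integral_sub (h1.const_mul _) (integrable_const _),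
    integral_const_mul, integral_sub h (integrable_const _), integral_id_gaussianReal]
  simp

-- Whether `t < τ` is decided by the first `t` rounds. Given these and the arm, the reward can be
-- integrated out, leaving minus the Gaussian relative entropy of that arm.
open Classical in
lemma integral_logLR_round (A : BAIAlgorithm K) (θ ν : Fin K → ℝ) (t : ℕ) :
    Integrable (fun ω => if (t : ℕ∞) < A.τ ω then logLR θ ν (ω t) else 0) (A.law θ) ∧
    ∫ ω, (if (t : ℕ∞) < A.τ ω then logLR θ ν (ω t) else 0) ∂A.law θ =
      -∫ ω, (if (t : ℕ∞) < A.τ ω then (ν (ω t).1 - θ (ω t).1) ^ 2 / 2 else 0) ∂A.law θ := by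
  obtain ⟨u, hu, hut⟩ := A.measurableSet_lt t
  have hiff : ∀ ω : Trajectory K, (t : ℕ∞) < A.τ ω ↔ firstRounds t ω ∈ u := fun ω => by
    change ω ∈ {ω | (t : ℕ∞) < A.τ ω} ↔ _
    rw [← hut]
    rfl
  simp only [hiff]
  let g : ((Fin t → Fin K × ℝ) × Fin K) × ℝ → ℝ :=
    fun z => if z.1.1 ∈ u then logLR θ ν (z.1.2, z.2) else 0
  let q : (Fin t → Fin K × ℝ) × Fin K → ℝ :=
    fun z => if z.1 ∈ u then (ν z.2 - θ z.2) ^ 2 / 2 else 0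
  have hg : Measurable g := Measurable.ite (measurable_fst.fst hu) (by fun_prop) measurable_const
  have hq : Measurable q := by
    refine Measurable.ite (measurable_fst hu) ?_ measurable_const
    exact (measurable_of_countable fun a => (ν a - θ a) ^ 2 / 2).comp measurable_snd
  have hX : Measurable fun ω : Trajectory K => ((firstRounds t ω, (ω t).1), (ω t).2) := by fun_prop
  have hY : Measurable fun ω : Trajectory K => (firstRounds t ω, (ω t).1) := by fun_prop
  have hprob : IsProbabilityMeasure ((A.law θ).map fun ω => (firstRounds t ω, (ω t).1)) :=
    Measure.isProbabilityMeasure_map hY.aemeasurable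
  have hint : Integrable g ((A.law θ).map fun ω => ((firstRounds t ω, (ω t).1), (ω t).2)) := by
    rw [map_law_reward, Measure.integrable_compProd_iff hg.aestronglyMeasurable]
    refine ⟨Eventually.of_forall fun z => ?_, ?_⟩
    · by_cases hz : z.1 ∈ u
      · simpa [g, hz] using integrable_logLR_reward θ ν z.2
      · simp [g, hz]
    · refine Integrable.of_bound (C := ∑ a, ∫ r, ‖logLR θ ν (a, r)‖ ∂reward θ a) ?_ ?_
      · exact (hg.norm.stronglyMeasurable.integral_kernel_prod_right').aestronglyMeasurable
      · refine Eventually.of_forall fun z => ?_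
        have h0 : ∀ a, 0 ≤ ∫ r, ‖logLR θ ν (a, r)‖ ∂reward θ a := fun a =>
          integral_nonneg fun _ => norm_nonneg _
        by_cases hz : z.1 ∈ u
        · simp only [g, hz, if_true, Kernel.prodMkLeft_apply]
          rw [Real.norm_of_nonneg (h0 _)]
          exact Finset.single_le_sum (f := fun a => ∫ r, ‖logLR θ ν (a, r)‖ ∂reward θ a)
            (fun a _ => h0 a) (Finset.mem_univ z.2)
        · simpa [g, hz] using Finset.sum_nonneg fun a _ => h0 a
  refine ⟨(integrable_map_measure hg.aestronglyMeasurable hX.aemeasurable).1 hint, ?_⟩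
  have e1 : ∫ ω, (if firstRounds t ω ∈ u then logLR θ ν (ω t) else 0) ∂A.law θ =
      ∫ z, g z ∂((A.law θ).map fun ω => ((firstRounds t ω, (ω t).1), (ω t).2)) :=
    (integral_map hX.aemeasurable hg.aestronglyMeasurable).symm
  have e2 : ∫ ω, (if firstRounds t ω ∈ u then (ν (ω t).1 - θ (ω t).1) ^ 2 / 2 else 0) ∂A.law θ =
      ∫ z, q z ∂((A.law θ).map fun ω => (firstRounds t ω, (ω t).1)) :=
    (integral_map hY.aemeasurable hq.aestronglyMeasurable).symm
  rw [e1, e2, map_law_reward, Measure.integral_compProd (by rwa [← map_law_reward]),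
    ← integral_neg]
  refine integral_congr_ae (Eventually.of_forall fun z => ?_)
  by_cases hz : z.1 ∈ u
  · simpa [g, q, hz] using integral_logLR_reward θ ν z.2
  · simp [g, q, hz]

open Classical in
lemma measurable_visits (A : BAIAlgorithm K) (a : Fin K) : Measurable (A.visits a) := by
  unfold visits
  refine Measurable.tsum fun t => Measurable.ite ?_ measurable_const measurable_const
  refine ((history K).le t _ (A.measurableSet_lt t)).inter ?_
  exact (measurable_fst.comp (measurable_pi_apply t)) (measurableSet_singleton a)

/-- Wald's identity for the log-likelihood ratio, as a bound. -/
lemma integral_stoppedLogLR_ge (A : BAIAlgorithm K) (θ ν : Fin K → ℝ) (n : ℕ)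
    (hfin : ∀ a, A.expVisits θ a ≠ ⊤) :
    Integrable (A.stoppedLogLR θ ν n) (A.law θ) ∧
    -∑ a, (A.expVisits θ a).toReal * ((ν a - θ a) ^ 2 / 2) ≤
      ∫ ω, A.stoppedLogLR θ ν n ω ∂A.law θ := by
  classical
  refine ⟨integrable_finsetSum _ fun t _ => (A.integral_logLR_round θ ν t).1, ?_⟩
  have hq0 : ∀ (t : ℕ) (ω : Trajectory K),
      0 ≤ (if (t : ℕ∞) < A.τ ω then (ν (ω t).1 - θ (ω t).1) ^ 2 / 2 else 0) := fun t ω => by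
    split_ifs <;> positivity
  have hqm : ∀ t : ℕ, Measurable fun ω : Trajectory K =>
      (if (t : ℕ∞) < A.τ ω then (ν (ω t).1 - θ (ω t).1) ^ 2 / 2 else 0) := fun t => by
    refine Measurable.ite ((history K).le t _ (A.measurableSet_lt t)) ?_ measurable_const
    exact (measurable_of_countable fun a => (ν a - θ a) ^ 2 / 2).comp
      (measurable_fst.comp (measurable_pi_apply t))
  have hqi : ∀ t : ℕ, Integrable (fun ω : Trajectory K =>
      (if (t : ℕ∞) < A.τ ω then (ν (ω t).1 - θ (ω t).1) ^ 2 / 2 else 0)) (A.law θ) := fun t => by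
    refine Integrable.of_bound (hqm t).aestronglyMeasurable (∑ a, (ν a - θ a) ^ 2 / 2)
      (Eventually.of_forall fun ω => ?_)
    rw [Real.norm_of_nonneg (hq0 t ω)]
    split_ifs
    · exact Finset.single_le_sum (f := fun a => (ν a - θ a) ^ 2 / 2) (fun a _ => by positivity)
        (Finset.mem_univ (ω t).1)
    · positivity
  unfold stoppedLogLR
  rw [integral_finsetSum _ fun t _ => (A.integral_logLR_round θ ν t).1,
    Finset.sum_congr rfl fun t _ => (A.integral_logLR_round θ ν t).2, Finset.sum_neg_distrib,
    neg_le_neg_iff, ← integral_finsetSum _ fun t _ => hqi t]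
  have hS0 : ∀ ω : Trajectory K, 0 ≤ ∑ t ∈ Finset.range n,
      (if (t : ℕ∞) < A.τ ω then (ν (ω t).1 - θ (ω t).1) ^ 2 / 2 else 0) := fun ω =>
    Finset.sum_nonneg fun t _ => hq0 t ω
  rw [integral_eq_lintegral_of_nonneg_ae (Eventually.of_forall hS0)
    (Finset.measurable_sum _ fun t _ => hqm t).aestronglyMeasurable]
  have hrhs : ∑ a, (A.expVisits θ a).toReal * ((ν a - θ a) ^ 2 / 2) =
      (∑ a, A.expVisits θ a * ENNReal.ofReal ((ν a - θ a) ^ 2 / 2)).toReal := by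
    rw [ENNReal.toReal_sum fun a _ => ENNReal.mul_ne_top (hfin a) ENNReal.ofReal_ne_top]
    refine Finset.sum_congr rfl fun a _ => ?_
    rw [ENNReal.toReal_mul, ENNReal.toReal_ofReal (by positivity)]
  rw [hrhs]
  refine ENNReal.toReal_mono (ENNReal.sum_ne_top.2 fun a _ =>
    ENNReal.mul_ne_top (hfin a) ENNReal.ofReal_ne_top) ?_
  simp only [expVisits]
  simp_rw [← lintegral_mul_const _ (A.measurable_visits _)]
  rw [← lintegral_finsetSum _ fun a _ => (A.measurable_visits a).mul_const _]
  refine lintegral_mono fun ω => ?_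
  rw [ENNReal.ofReal_sum_of_nonneg fun t _ => hq0 t ω]
  -- Only rounds before `n` enter the stopped ratio, while `visits` counts all rounds before `τ`;
  -- this is the source of the inequality.
  have h1 : ∀ a, ∑ t ∈ Finset.range n, (if (t : ℕ∞) < A.τ ω ∧ (ω t).1 = a then (1 : ℝ≥0∞) else 0) *
      ENNReal.ofReal ((ν a - θ a) ^ 2 / 2) ≤
      A.visits a ω * ENNReal.ofReal ((ν a - θ a) ^ 2 / 2) := fun a => by
    rw [← Finset.sum_mul]
    gcongr
    convert! ENNReal.sum_le_tsum (Finset.range n)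
  refine le_trans ?_ (Finset.sum_le_sum fun a _ => h1 a)
  rw [Finset.sum_comm]
  refine Finset.sum_le_sum fun t _ => ?_
  by_cases ht : (t : ℕ∞) < A.τ ω
  · simp [ht]
  · simp [ht]

/-- The transportation inequality, in the form of Donsker and Varadhan's variational bound. -/
lemma transportation (A : BAIAlgorithm K) (θ ν : Fin K → ℝ) (n : ℕ)
    (hfin : ∀ a, A.expVisits θ a ≠ ⊤) {s : Set (Trajectory K)}
    (hs : MeasurableSet[A.isStoppingTime_τ.measurableSpace] s) {x : ℝ} (hx : 0 ≤ x) :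
    x * (A.law θ).real (s ∩ {ω | A.τ ω ≤ n}) ≤
      Real.log (1 + (Real.exp x - 1) * (A.law ν).real (s ∩ {ω | A.τ ω ≤ n})) +
      ∑ a, (A.expVisits θ a).toReal * ((ν a - θ a) ^ 2 / 2) := by
  obtain ⟨hTi, hT⟩ := A.integral_stoppedLogLR_ge θ ν n hfin
  have hTm := A.measurable_stoppedLogLR θ ν n
  set T := A.stoppedLogLR θ ν n
  set S := s ∩ {ω | A.τ ω ≤ n}
  have hS : MeasurableSet S := (history K).le n _ (hs.2 n)
  have hl := A.lintegral_exp_stoppedLogLR θ ν n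
  have hei : Integrable (fun ω => Real.exp (T ω)) (A.law θ) := by
    refine ⟨hTm.exp.aestronglyMeasurable, ?_⟩
    rw [hasFiniteIntegral_iff_ofReal (Eventually.of_forall fun ω => (Real.exp_pos _).le), hl]
    exact ENNReal.one_lt_top
  have he1 : ∫ ω, Real.exp (T ω) ∂A.law θ = 1 := by
    rw [integral_eq_lintegral_of_nonneg_ae (Eventually.of_forall fun ω => (Real.exp_pos _).le)
      hTm.exp.aestronglyMeasurable, hl, ENNReal.toReal_one]
  have heS : ∫ ω in S, Real.exp (T ω) ∂A.law θ = (A.law ν).real S := by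
    rw [integral_eq_lintegral_of_nonneg_ae (Eventually.of_forall fun ω => (Real.exp_pos _).le)
      hTm.exp.aestronglyMeasurable.restrict, measureReal_def, A.law_change_stopped θ ν n hs]
  -- `m` is the `ν`-expectation of `exp (x 1_S)`, the normalising constant of the variational bound.
  set m := 1 + (Real.exp x - 1) * (A.law ν).real S
  have hm : 0 < m := by
    have : 0 ≤ (Real.exp x - 1) * (A.law ν).real S :=
      mul_nonneg (by linarith [Real.one_le_exp hx]) measureReal_nonneg
    linarith
  -- This is `y + 1 ≤ exp y` at `y = x 1_S + T - log m`. The right side has `θ`-integral `m⁻¹ * m =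
  -- 1`, so integrating gives Donsker–Varadhan.
  have hpt : ∀ ω, S.indicator (fun _ => x) ω + T ω - Real.log m + 1 ≤
      m⁻¹ * (Real.exp (T ω) + (Real.exp x - 1) * S.indicator (fun ω => Real.exp (T ω)) ω) := by
    intro ω
    refine (Real.add_one_le_exp _).trans_eq ?_
    rw [Real.exp_sub, Real.exp_log hm, Real.exp_add, div_eq_inv_mul]
    congr 1
    by_cases h : ω ∈ S
    · simp only [Set.indicator_of_mem h]
      ring
    · simp [Set.indicator_of_notMem h]
  have hxi : Integrable (S.indicator fun _ => x) (A.law θ) := (integrable_const x).indicator hS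
  have h1 : Integrable (fun ω => S.indicator (fun _ => x) ω + T ω) (A.law θ) := hxi.add hTi
  have h2 : Integrable (fun ω => S.indicator (fun _ => x) ω + T ω - Real.log m) (A.law θ) :=
    h1.sub (integrable_const _)
  have h3 : Integrable (fun ω => (Real.exp x - 1) * S.indicator (fun ω => Real.exp (T ω)) ω)
      (A.law θ) := (hei.indicator hS).const_mul _
  have hint := integral_mono (μ := A.law θ) (h2.add (integrable_const 1))
    ((hei.add h3).const_mul m⁻¹) hpt
  simp only [Pi.add_apply] at hint
  rw [integral_add h2 (integrable_const 1), integral_sub h1 (integrable_const (Real.log m)),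
    integral_add hxi hTi,
    integral_const_mul, integral_add hei h3, integral_const_mul,
    integral_indicator hS, integral_indicator hS, he1, heS, inv_mul_cancel₀ hm.ne'] at hint
  simp only [integral_const, probReal_univ, smul_eq_mul, one_mul,
    measureReal_restrict_apply MeasurableSet.univ, Set.univ_inter] at hint
  linarith

end BAIAlgorithm

/-! ### Numerical bound for the binary relative entropy. -/

lemma mul_log_ge_tangent {c x : ℝ} (hc : 0 < c) (hx : 0 < x) :
    x * Real.log c + (x - c) ≤ x * Real.log x := by
  have h := Real.log_le_sub_one_of_pos (div_pos hc hx)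
  rw [Real.log_div hc.ne' hx.ne'] at h
  have h2 := mul_le_mul_of_nonneg_left h hx.le
  have h3 : x * (c / x - 1) = c - x := by field_simp
  linarith [h2, h3, mul_sub x (Real.log c) (Real.log x)]

lemma log_le_tangent {c x : ℝ} (hc : 0 < c) (hx : 0 < x) :
    Real.log x ≤ Real.log c + (x / c - 1) := by
  have h := Real.log_le_sub_one_of_pos (div_pos hx hc)
  rw [Real.log_div hx.ne' hc.ne'] at h
  linarith

/-- The binary relative entropy `kl(δ, 1 - δ)` is at least `log (1 / (2.4 δ))`. -/
lemma log_le_binary_kl {δ : ℝ} (hδ : δ ∈ Set.Ioo (0 : ℝ) (1 / 2)) :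
    Real.log (1 / (2.4 * δ)) ≤ (1 - 2 * δ) * Real.log ((1 - δ) / δ) := by
  obtain ⟨h0, h1⟩ := hδ
  have hu : 0 < 1 - δ := by linarith
  rw [Real.log_div hu.ne' h0.ne', one_div, Real.log_inv,
    Real.log_mul (by norm_num) h0.ne']
  -- The difference of the two sides is `2 (δ log δ + (1 - δ) log (1 - δ)) - log (1 - δ) + log 2.4`,
  -- convex in `δ`. Each term is replaced by its tangent at `δ = 10 / 31`, a rational point close to
  -- the minimiser.
  have t1 := mul_log_ge_tangent (c := 10 / 31) (by norm_num) h0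
  have t2 := mul_log_ge_tangent (c := 21 / 31) (by norm_num) hu
  have t3 := log_le_tangent (c := 21 / 31) (by norm_num) hu
  -- With the constants of `b1` and `b2` the resulting affine lower bound is identically zero.
  have b1 : 10 / 21 ≤ Real.log (21 / 31) + Real.log 2.4 := by
    rw [← Real.log_mul (by norm_num) (by norm_num)]
    -- `3 ^ 20 / 2 ^ 31` lies just below `21 / 31 * 2.4`, and its logarithm involves only `log 2`
    -- and `log 3`.
    have h : Real.log (3 ^ 20 / 2 ^ 31) ≤ Real.log (21 / 31 * 2.4) :=
      Real.log_le_log (by norm_num) (by norm_num)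
    rw [Real.log_div (by norm_num) (by norm_num), Real.log_pow, Real.log_pow] at h
    push_cast at h
    linarith [Real.log_two_lt_d9, Real.log_three_gt_d9]
  have b2 : -(11 / 42) ≤ Real.log (10 / 31) + Real.log 2.4 := by
    rw [← Real.log_mul (by norm_num) (by norm_num)]
    have h : Real.log (10 / 31 * 2.4) = Real.log (3 / 4) - Real.log (31 / 32) := by
      rw [← Real.log_div (by norm_num) (by norm_num)]
      norm_num
    have h2 : Real.log (31 / 32) ≤ 31 / 32 - 1 := Real.log_le_sub_one_of_pos (by norm_num)
    have h3 : Real.log (3 / 4) = Real.log 3 - 2 * Real.log 2 := by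
      rw [Real.log_div (by norm_num) (by norm_num), show (4 : ℝ) = 2 ^ 2 by norm_num, Real.log_pow]
      norm_num
    linarith [Real.log_two_lt_d9, Real.log_three_gt_d9]
  have e1 := mul_le_mul_of_nonneg_left b1 (show (0 : ℝ) ≤ 1 - 2 * δ by linarith)
  have e2 := mul_le_mul_of_nonneg_left b2 (show (0 : ℝ) ≤ 2 * δ by linarith)
  have e3 : (1 - δ) / (21 / 31) = 31 / 21 - 31 / 21 * δ := by ring
  rw [e3] at t3
  nlinarith

lemma binary_kl_pos {δ : ℝ} (hδ : δ ∈ Set.Ioo (0 : ℝ) (1 / 2)) :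
    0 < (1 - 2 * δ) * Real.log ((1 - δ) / δ) := by
  obtain ⟨h0, h1⟩ := hδ
  refine mul_pos (by linarith) (Real.log_pos ?_)
  rw [lt_div_iff₀ h0]
  linarith

/-! ### Information needed to separate two models. -/

namespace BAIAlgorithm

lemma sum_expVisits (A : BAIAlgorithm K) (θ : Fin K → ℝ) :
    ∑ a, A.expVisits θ a = A.sampleComplexity θ := by
  classical
  unfold expVisits sampleComplexity
  rw [← lintegral_finsetSum _ fun a _ => A.measurable_visits a]
  refine lintegral_congr fun ω => ?_
  have h1 : ∑ a, A.visits a ω = ∑' t : ℕ, if (t : ℕ∞) < A.τ ω then (1 : ℝ≥0∞) else 0 := by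
    unfold visits
    rw [← Summable.tsum_finsetSum fun a _ => ENNReal.summable]
    refine tsum_congr fun t => ?_
    by_cases h : (t : ℕ∞) < A.τ ω <;> simp [h]
  rw [h1]
  cases A.τ ω with
  | top => simp
  | coe n =>
    rw [tsum_eq_sum (s := Finset.range n)]
    · rw [Finset.sum_congr rfl (g := fun _ => 1)]
      · simp
      · intro t ht
        rw [if_pos]
        exact_mod_cast Finset.mem_range.1 ht
    · intro t ht
      rw [if_neg]
      simpa using ht

lemma expVisits_ne_top (A : BAIAlgorithm K) {θ : Fin K → ℝ} (hfin : A.sampleComplexity θ ≠ ⊤)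
    (c : Fin K) : A.expVisits θ c ≠ ⊤ :=
  ne_top_of_le_ne_top hfin (by
    rw [← A.sum_expVisits θ]
    exact Finset.single_le_sum (f := fun c => A.expVisits θ c) (fun _ _ => zero_le)
      (Finset.mem_univ c))

lemma measurableSet_guess_eq (A : BAIAlgorithm K) (a : Fin K) :
    MeasurableSet[A.isStoppingTime_τ.measurableSpace] {ω | A.guess ω = a} :=
  A.measurable_guess (measurableSet_singleton a)

end BAIAlgorithm

open BAIAlgorithm

/-- Two models with different best arms are separated by the information that a `δ`-PAC algorithm
gathers. -/
lemma IsPAC.binary_kl_le {A : BAIAlgorithm K} {δ : ℝ} (hδ : δ ∈ Set.Ioo (0 : ℝ) (1 / 2))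
    (hA : IsPAC δ A) {θ ν : Fin K → ℝ} {a b : Fin K} (ha : IsUniqueBestArm θ a)
    (hb : IsUniqueBestArm ν b) (hab : a ≠ b) (hfin : A.sampleComplexity θ ≠ ⊤) :
    (1 - 2 * δ) * Real.log ((1 - δ) / δ) ≤
      ∑ c, (A.expVisits θ c).toReal * ((ν c - θ c) ^ 2 / 2) := by
  have hNfin := A.expVisits_ne_top hfin
  obtain ⟨h0, h1⟩ := hδ
  set s : Set (Trajectory K) := {ω | A.guess ω = a}
  have hs := A.measurableSet_guess_eq a
  have hsm : MeasurableSet s := A.isStoppingTime_τ.measurableSpace_le _ hs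
  have hτm : ∀ n : ℕ, MeasurableSet {ω | A.τ ω ≤ n} := fun n =>
    (history K).le n _ (A.measurableSet_le n)
  have hq : ∀ n : ℕ, (A.law ν).real (s ∩ {ω | A.τ ω ≤ n}) ≤ δ := fun n => by
    refine ENNReal.toReal_le_of_le_ofReal h0.le (le_trans (measure_mono ?_) (hA ν b hb).1)
    rintro ω ⟨h, -⟩ h'
    exact hab (h.symm.trans h')
  have hU : (⋃ n : ℕ, s ∩ {ω | A.τ ω ≤ n}) = s ∩ {ω | A.τ ω < ⊤} := by
    rw [← Set.inter_iUnion]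
    congr 1
    ext ω
    simp only [Set.mem_iUnion, Set.mem_ofPred_eq]
    constructor
    · rintro ⟨n, hn⟩
      exact lt_of_le_of_lt hn (ENat.natCast_lt_top n)
    · intro h
      obtain ⟨n, hn⟩ := ENat.ne_top_iff_exists.1 h.ne
      exact ⟨n, hn.ge⟩
  have hp : 1 - δ ≤ (A.law θ).real (⋃ n : ℕ, s ∩ {ω | A.τ ω ≤ n}) := by
    have hT : ∀ᵐ ω ∂A.law θ, A.τ ω < ⊤ := by
      have hm : MeasurableSet {ω | A.τ ω < ⊤} := by
        have h : {ω | A.τ ω < ⊤} = ⋃ n : ℕ, {ω | A.τ ω ≤ n} := by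
          ext ω
          simp only [Set.mem_iUnion, Set.mem_ofPred_eq]
          exact ⟨fun h => (ENat.ne_top_iff_exists.1 h.ne).imp fun n hn => hn.ge,
            fun ⟨n, hn⟩ => lt_of_le_of_lt hn (ENat.natCast_lt_top n)⟩
        rw [h]
        exact MeasurableSet.iUnion hτm
      exact (prob_compl_eq_zero_iff hm).2 (hA θ a ha).2
    have e : (A.law θ).real (s ∩ {ω | A.τ ω < ⊤}) = (A.law θ).real s :=
      measureReal_congr (by
        filter_upwards [hT] with ω hω
        exact propext ⟨fun h => h.1, fun h => ⟨h, hω⟩⟩)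
    rw [hU, e]
    have h2 : (A.law θ).real sᶜ ≤ δ := ENNReal.toReal_le_of_le_ofReal h0.le (hA θ a ha).1
    rw [probReal_compl_eq_one_sub hsm] at h2
    linarith
  have hmono : Monotone fun n : ℕ => s ∩ {ω | A.τ ω ≤ n} := fun m n hmn ω hω =>
    ⟨hω.1, (show A.τ ω ≤ m from hω.2).trans (Nat.cast_le.2 hmn)⟩
  have hlim : Tendsto (fun n : ℕ => (A.law θ).real (s ∩ {ω | A.τ ω ≤ n})) atTop
      (𝓝 ((A.law θ).real (⋃ n : ℕ, s ∩ {ω | A.τ ω ≤ n}))) :=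
    (ENNReal.tendsto_toReal (measure_ne_top _ _)).comp (tendsto_measure_iUnion_atTop hmono)
  have hr : 1 < (1 - δ) / δ := by
    rw [lt_div_iff₀ h0]
    linarith
  have hlog := Real.log_pos hr
  set X := Real.log ((1 - δ) / δ) with hX
  have hexp : Real.exp (2 * X) = ((1 - δ) / δ) ^ 2 := by
    rw [two_mul, Real.exp_add, hX, Real.exp_log (by linarith)]
    ring
  -- `x = 2 X` is the optimal parameter: it makes `1 + (exp x - 1) δ` equal to `(1 - δ) / δ`, so the
  -- logarithmic term is at most `X`. Letting `n → ∞` then gives `2 X (1 - δ) ≤ X + ∑`, which is the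
  -- claim.
  have hbound : ∀ n : ℕ, 2 * X * (A.law θ).real (s ∩ {ω | A.τ ω ≤ n}) ≤
      X + ∑ c, (A.expVisits θ c).toReal * ((ν c - θ c) ^ 2 / 2) := fun n => by
    refine (A.transportation θ ν n hNfin hs (x := 2 * X) (by linarith)).trans ?_
    have hge : 1 ≤ ((1 - δ) / δ) ^ 2 := by nlinarith
    gcongr
    rw [hexp]
    refine Real.log_le_log ?_ ?_
    · have := mul_nonneg (sub_nonneg.2 hge)
        (measureReal_nonneg (μ := A.law ν) (s := s ∩ {ω | A.τ ω ≤ n}))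
      linarith
    · have := mul_le_mul_of_nonneg_left (hq n) (sub_nonneg.2 hge)
      refine (add_le_add_right this 1).trans_eq ?_
      field_simp
      ring
  have hfinal := le_of_tendsto' (hlim.const_mul (2 * X)) hbound
  have := mul_le_mul_of_nonneg_left hp (show 0 ≤ 2 * X by linarith)
  linarith

/-- Breaks all ties, so that the perturbed model has a unique best arm and the PAC property applies
to it. Equal entries of `ν` are separated by `v`, distinct ones stay distinct by continuity. -/
lemma eventually_injective_perturb (ν v : Fin K → ℝ) (hv : Function.Injective v) :
    ∀ᶠ ε in 𝓝[>] (0 : ℝ), Function.Injective fun b => ν b + ε * v b := by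
  have h : ∀ b c : Fin K, ∀ᶠ ε in 𝓝[>] (0 : ℝ), b ≠ c → ν b + ε * v b ≠ ν c + ε * v c := by
    intro b c
    by_cases hbc : b = c
    · simp [hbc]
    by_cases hν : ν b = ν c
    · filter_upwards [self_mem_nhdsWithin] with ε hε _
      have hε' : ε ≠ 0 := (Set.mem_Ioi.1 hε).ne'
      simpa [hν, hε'] using fun h => hbc (hv h)
    · have hc : Continuous fun ε : ℝ => (ν b + ε * v b) - (ν c + ε * v c) := by fun_prop
      have h0 := hc.continuousAt (x := 0) |>.eventually_ne (y := 0)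
        (by simpa using sub_ne_zero.2 hν)
      filter_upwards [nhdsWithin_le_nhds h0] with ε hε _
      exact sub_ne_zero.1 hε
  have h2 : ∀ᶠ ε in 𝓝[>] (0 : ℝ), ∀ b c : Fin K, b ≠ c → ν b + ε * v b ≠ ν c + ε * v c :=
    eventually_all.2 fun b => eventually_all.2 fun c => h b c
  filter_upwards [h2] with ε hε b c hbc
  by_contra hne
  exact hε b c hne hbc

/-- The same bound for a model `ν` on the boundary of the set of alternatives to `θ`. -/
lemma IsPAC.binary_kl_le_of_le {A : BAIAlgorithm K} {δ : ℝ} (hδ : δ ∈ Set.Ioo (0 : ℝ) (1 / 2))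
    (hA : IsPAC δ A) {θ ν : Fin K → ℝ} {a b : Fin K} (ha : IsUniqueBestArm θ a)
    (hab : b ≠ a) (hν : ν a ≤ ν b) (hfin : A.sampleComplexity θ ≠ ⊤) :
    (1 - 2 * δ) * Real.log ((1 - δ) / δ) ≤
      ∑ c, (A.expVisits θ c).toReal * ((ν c - θ c) ^ 2 / 2) := by
  -- Distinct entries with the largest at `b`: even if `ν a = ν b`, the perturbation puts `b`
  -- strictly above `a`, so `a` is not the best arm.
  let v : Fin K → ℝ := fun c => if c = b then (K : ℝ) else (c : ℕ)
  have hlt : ∀ c : Fin K, ((c : ℕ) : ℝ) < K := fun c => by exact_mod_cast c.2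
  have hv : Function.Injective v := by
    intro c d hcd
    by_cases h1 : c = b <;> by_cases h2 : d = b
    · exact h1.trans h2.symm
    · simp only [v, h1, h2, if_true, if_false] at hcd
      exact absurd hcd (hlt d).ne'
    · simp only [v, h1, h2, if_true, if_false] at hcd
      exact absurd hcd (hlt c).ne
    · simp only [v, h1, h2, if_false] at hcd
      exact Fin.ext (by exact_mod_cast hcd)
  have hvab : v a < v b := by simp [v, hab.symm]
  have hc : Continuous fun ε : ℝ =>
      ∑ c, (A.expVisits θ c).toReal * ((ν c + ε * v c - θ c) ^ 2 / 2) := by fun_prop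
  have hlim : Tendsto (fun ε : ℝ =>
      ∑ c, (A.expVisits θ c).toReal * ((ν c + ε * v c - θ c) ^ 2 / 2)) (𝓝[>] 0)
      (𝓝 (∑ c, (A.expVisits θ c).toReal * ((ν c - θ c) ^ 2 / 2))) := by
    have := (hc.tendsto 0).mono_left (nhdsWithin_le_nhds (s := Set.Ioi 0))
    simpa using this
  refine ge_of_tendsto hlim ?_
  filter_upwards [eventually_injective_perturb ν v hv, self_mem_nhdsWithin] with ε hinj hε
  have : Nonempty (Fin K) := ⟨a⟩
  obtain ⟨m, hm⟩ := Finite.exists_max fun c => ν c + ε * v c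
  have hbest : IsUniqueBestArm (fun c => ν c + ε * v c) m := fun c hcm =>
    lt_of_le_of_ne (hm c) fun h => hcm (hinj h)
  refine hA.binary_kl_le hδ ha hbest ?_ hfin
  rintro rfl
  have h1 := hm b
  have h2 : ε * v a < ε * v b := mul_lt_mul_of_pos_left hvab hε
  linarith

/-! ### Optimal alternatives and the weight vector. -/

lemma harmonic_bound {n m x y k : ℝ} (hn : 0 ≤ n) (hm : 0 ≤ m) (hk : 0 < k) (hxy : x < y)
    (h : ∀ z, k ≤ n * ((z - x) ^ 2 / 2) + m * ((z - y) ^ 2 / 2)) :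
    0 < n ∧ 0 < m ∧ 2 * (n⁻¹ + m⁻¹) / (y - x) ^ 2 * k ≤ 1 := by
  have hn' : 0 < n := by
    refine lt_of_le_of_ne hn fun h0 => ?_
    have := h y
    simp [← h0] at this
    linarith
  have hm' : 0 < m := by
    refine lt_of_le_of_ne hm fun h0 => ?_
    have := h x
    simp [← h0] at this
    linarith
  refine ⟨hn', hm', ?_⟩
  have hd : 0 < y - x := sub_pos.2 hxy
  -- The weighted mean minimises the quadratic in `z`, with minimum `n m (y - x)² / (2 (n + m))`.
  have h1 := h ((n * x + m * y) / (n + m))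
  have h2 : n * (((n * x + m * y) / (n + m) - x) ^ 2 / 2) +
      m * (((n * x + m * y) / (n + m) - y) ^ 2 / 2) = n * m / (n + m) * (y - x) ^ 2 / 2 := by
    field_simp
    ring
  rw [h2] at h1
  have h3 : 0 ≤ 2 * (n⁻¹ + m⁻¹) / (y - x) ^ 2 := by positivity
  refine (mul_le_mul_of_nonneg_left h1 h3).trans_eq ?_
  field_simp
  ring

/-- The selection rates of a `δ`-PAC algorithm with finite sample complexity form a weight vector
for which the sample complexity dominates the objective of the characteristic time. -/
lemma IsPAC.exists_weights {A : BAIAlgorithm K} {δ : ℝ} (hδ : δ ∈ Set.Ioo (0 : ℝ) (1 / 2))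
    (hA : IsPAC δ A) {θ : Fin K → ℝ} {a b : Fin K} (ha : IsUniqueBestArm θ a)
    (hab : b ≠ a) (hfin : A.sampleComplexity θ ≠ ⊤) :
    ∃ w ∈ stdSimplex ℝ (Fin K), (∀ c, A.selectionRate θ c = ENNReal.ofReal (w c)) ∧
      ∀ c, c ≠ a → 2 * (((ENNReal.ofReal (w c))⁻¹ + (ENNReal.ofReal (w a))⁻¹) /
        ENNReal.ofReal ((θ a - θ c) ^ 2)) * ENNReal.ofReal (Real.log (1 / (2.4 * δ))) ≤
          A.sampleComplexity θ := by
  have hNfin := A.expVisits_ne_top hfin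
  have hk := binary_kl_pos hδ
  set k := (1 - 2 * δ) * Real.log ((1 - δ) / δ)
  set N : Fin K → ℝ := fun c => (A.expVisits θ c).toReal
  set E : ℝ := (A.sampleComplexity θ).toReal
  have hN0 : ∀ c, 0 ≤ N c := fun c => ENNReal.toReal_nonneg
  have hsum : ∑ c, N c = E := by
    simp only [N, E]
    rw [← ENNReal.toReal_sum fun c _ => hNfin c, A.sum_expVisits]
  have hbd : ∀ c, c ≠ a → 0 < N c ∧ 0 < N a ∧
      2 * ((N c)⁻¹ + (N a)⁻¹) / (θ a - θ c) ^ 2 * k ≤ 1 := fun c hca => by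
    refine harmonic_bound (hN0 c) (hN0 a) hk (ha c hca) fun z => ?_
    refine (hA.binary_kl_le_of_le hδ (ν := fun d => if d = c ∨ d = a then z else θ d) ha hca
      (by simp) hfin).trans_eq ?_
    rw [Finset.sum_eq_add c a hca]
    · simp [N]
    · rintro d - ⟨h1, h2⟩
      simp [h1, h2]
    · simp
    · simp
  -- The second arm `b` is needed here: it forces a positive expected number of selections of `a`.
  have hE : 0 < E := by
    rw [← hsum]
    exact (hbd b hab).2.1.trans_le (Finset.single_le_sum (fun c _ => hN0 c) (Finset.mem_univ a))
  refine ⟨fun c => N c / E, ⟨fun c => div_nonneg (hN0 c) hE.le, ?_⟩, fun c => ?_, fun c hca => ?_⟩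
  · rw [← Finset.sum_div, hsum, div_self hE.ne']
  · rw [selectionRate, if_neg hfin, ENNReal.ofReal_div_of_pos hE, ENNReal.ofReal_toReal (hNfin c),
      ENNReal.ofReal_toReal hfin]
  · obtain ⟨hc, ha', hle⟩ := hbd c hca
    have hd : 0 < (θ a - θ c) ^ 2 := pow_pos (sub_pos.2 (ha c hca)) 2
    rw [← ENNReal.ofReal_inv_of_pos (div_pos hc hE), ← ENNReal.ofReal_inv_of_pos (div_pos ha' hE),
      ← ENNReal.ofReal_add (by positivity) (by positivity), ← ENNReal.ofReal_div_of_pos hd,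
      ← ENNReal.ofReal_ofNat 2, ← ENNReal.ofReal_mul (by norm_num),
      ← ENNReal.ofReal_mul (by positivity), ← ENNReal.ofReal_toReal hfin]
    refine ENNReal.ofReal_le_ofReal ?_
    have hkL : Real.log (1 / (2.4 * δ)) ≤ k := log_le_binary_kl hδ
    refine (mul_le_mul_of_nonneg_left hkL (by positivity)).trans ?_
    refine le_trans (le_of_eq ?_) ((mul_le_mul_of_nonneg_left hle hE.le).trans_eq (mul_one E))
    field_simp

/-! ### The two lower bounds. -/

lemma charTime_le {θ : Fin K → ℝ} {a : Fin K} {p w : Fin K → ℝ} (hw : w ∈ clippedSimplex p)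
    {C : ℝ≥0∞} (h : ∀ c, c ≠ a → 2 * (((ENNReal.ofReal (w c))⁻¹ + (ENNReal.ofReal (w a))⁻¹) /
      ENNReal.ofReal ((θ a - θ c) ^ 2)) ≤ C) : charTime θ a p ≤ C := by
  refine (mul_le_mul_right (iInf₂_le w hw) 2).trans ?_
  simp_rw [ENNReal.mul_iSup]
  exact iSup₂_le h

/-- With a single arm the maximum over rivals is empty, so it suffices that `Σ_p` is nonempty. -/
lemma charTime_eq_zero {θ : Fin K → ℝ} {a : Fin K} {p : Fin K → ℝ} (hp : IsFairnessRate p)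
    (h : ∀ b, b = a) : charTime θ a p = 0 := by
  refine le_antisymm (charTime_le (w := fun _ => 1) ⟨⟨fun _ => zero_le_one, ?_⟩, fun c => ?_⟩
    fun c hc => absurd (h c) hc) zero_le
  · rw [Finset.sum_eq_single a (fun b _ hb => absurd (h b) hb) (by simp)]
  · exact (Finset.single_le_sum (fun c _ => hp.1 c) (Finset.mem_univ c)).trans hp.2

lemma charTime_mul_log_le {p : Fin K → ℝ} (hp : IsFairnessRate p) {δ : ℝ}
    (hδ : δ ∈ Set.Ioo (0 : ℝ) (1 / 2)) {A : BAIAlgorithm K} (hA : IsFairPAC p δ A)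
    {θ : Fin K → ℝ} {a : Fin K} (ha : IsUniqueBestArm θ a) :
    charTime θ a p * ENNReal.ofReal (Real.log (1 / (2.4 * δ))) ≤ A.sampleComplexity θ := by
  by_cases hfin : A.sampleComplexity θ = ⊤
  · rw [hfin]
    exact le_top
  by_cases hK : ∀ b, b = a
  · rw [charTime_eq_zero hp hK, zero_mul]
    exact zero_le
  push Not at hK
  obtain ⟨b, hb⟩ := hK
  obtain ⟨w, hw, hrate, hle⟩ := hA.1.exists_weights hδ ha hb hfin
  have hwp : w ∈ clippedSimplex p := ⟨hw, fun c => by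
    have := hA.2 θ a ha c
    rw [hrate, ENNReal.ofReal_le_ofReal_iff (hw.1 c)] at this
    exact this⟩
  -- For `2.4 δ ≥ 1` the truncated logarithm is zero and cannot be divided by, but the bound is
  -- trivial.
  rcases eq_or_ne (ENNReal.ofReal (Real.log (1 / (2.4 * δ)))) 0 with h0 | h0
  · rw [h0, mul_zero]
    exact zero_le
  rw [← ENNReal.le_div_iff_mul_le (Or.inl h0) (Or.inl ENNReal.ofReal_ne_top)]
  refine charTime_le hwp fun c hc => ?_
  rw [ENNReal.le_div_iff_mul_le (Or.inl h0) (Or.inl ENNReal.ofReal_ne_top)]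
  exact hle c hc

/-- The argument of `ENNReal.ofReal` equals `log (1 / (2.4 δ)) / log (1 / δ)` for small `δ > 0`, so
the constant `2.4` disappears asymptotically. -/
lemma tendsto_log_ratio :
    Tendsto (fun δ : ℝ => ENNReal.ofReal (1 - Real.log 2.4 / Real.log (1 / δ))) (𝓝[>] 0)
      (𝓝 1) := by
  have h1 : Tendsto (fun δ : ℝ => Real.log (1 / δ)) (𝓝[>] 0) atTop := by
    simp only [one_div]
    exact Real.tendsto_log_atTop.comp tendsto_inv_nhdsGT_zero
  have h2 : Tendsto (fun δ : ℝ => 1 - Real.log 2.4 / Real.log (1 / δ)) (𝓝[>] 0) (𝓝 1) := by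
    simpa using (h1.const_div_atTop (Real.log 2.4)).const_sub 1
  simpa using ENNReal.tendsto_ofReal h2

lemma charTime_le_liminf {p : Fin K → ℝ} (hp : IsFairnessRate p) {A : ℝ → BAIAlgorithm K}
    (hPAC : ∀ δ ∈ Set.Ioo (0 : ℝ) (1 / 2), IsPAC δ (A δ)) {θ : Fin K → ℝ} {a : Fin K}
    (ha : IsUniqueBestArm θ a)
    (hfair : ∀ c, ENNReal.ofReal (p c) ≤
      liminf (fun δ => (A δ).selectionRate θ c) (𝓝[>] (0 : ℝ))) :
    charTime θ a p ≤ liminf (fun δ => (A δ).sampleComplexity θ /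
      ENNReal.ofReal (Real.log (1 / δ))) (𝓝[>] (0 : ℝ)) := by
  by_cases hK : ∀ b, b = a
  · rw [charTime_eq_zero hp hK]
    exact zero_le
  push Not at hK
  obtain ⟨b, hb⟩ := hK
  by_contra! hlt
  obtain ⟨C, hC1, hC2⟩ := exists_between hlt
  have hfreq : ∃ᶠ δ in 𝓝[>] (0 : ℝ), (A δ).sampleComplexity θ /
      ENNReal.ofReal (Real.log (1 / δ)) < C := frequently_lt_of_liminf_lt (by isBoundedDefault) hC1
  -- If the bound fails, some `C` below the characteristic time exceeds the ratio for arbitrarily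
  -- small `δ`. An ultrafilter on these `δ` serves as a convergent subsequence for the weights.
  let s : Set ℝ := {δ | (A δ).sampleComplexity θ / ENNReal.ofReal (Real.log (1 / δ)) < C}
  have hne : (𝓝[>] (0 : ℝ) ⊓ 𝓟 s).NeBot := frequently_mem_iff_neBot.1 hfreq
  obtain ⟨U, hU'⟩ := Ultrafilter.exists_le (𝓝[>] (0 : ℝ) ⊓ 𝓟 s)
  have hU : (U : Filter ℝ) ≤ 𝓝[>] (0 : ℝ) := hU'.trans inf_le_left
  have hUC : ∀ᶠ δ in (U : Filter ℝ), (A δ).sampleComplexity θ /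
    ENNReal.ofReal (Real.log (1 / δ)) < C := le_principal_iff.1 (hU'.trans inf_le_right)
  have hδ : ∀ᶠ δ in (U : Filter ℝ), δ ∈ Set.Ioo (0 : ℝ) (1 / 2) :=
    hU (Ioo_mem_nhdsGT (by norm_num))
  have hw : ∀ δ : ℝ, ∃ w : Fin K → ℝ, δ ∈ Set.Ioo (0 : ℝ) (1 / 2) →
      (A δ).sampleComplexity θ ≠ ⊤ →
      w ∈ stdSimplex ℝ (Fin K) ∧ (∀ c, (A δ).selectionRate θ c = ENNReal.ofReal (w c)) ∧
      ∀ c, c ≠ a → 2 * (((ENNReal.ofReal (w c))⁻¹ + (ENNReal.ofReal (w a))⁻¹) /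
        ENNReal.ofReal ((θ a - θ c) ^ 2)) * ENNReal.ofReal (Real.log (1 / (2.4 * δ))) ≤
          (A δ).sampleComplexity θ := fun δ => by
    by_cases h : δ ∈ Set.Ioo (0 : ℝ) (1 / 2) ∧ (A δ).sampleComplexity θ ≠ ⊤
    · obtain ⟨w, hw⟩ := (hPAC δ h.1).exists_weights h.1 ha hb h.2
      exact ⟨w, fun _ _ => hw⟩
    · exact ⟨0, fun h1 h2 => absurd ⟨h1, h2⟩ h⟩
  choose w hw using hw
  -- A ratio below `C` excludes infinite sample complexity, so the default rate `1` never occurs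
  -- along `U`.
  have hfin : ∀ᶠ δ in (U : Filter ℝ), (A δ).sampleComplexity θ ≠ ⊤ := by
    filter_upwards [hUC] with δ h htop
    rw [htop, ENNReal.top_div_of_ne_top ENNReal.ofReal_ne_top] at h
    exact not_top_lt h
  have hgood := hδ.and hfin
  obtain ⟨w₀, hw₀, hle⟩ := (isCompact_stdSimplex ℝ (Fin K)).ultrafilter_le_nhds (U.map w)
    (le_principal_iff.2 (mem_map.2 (hgood.mono fun δ h => (hw δ h.1 h.2).1)))
  have hlim : Tendsto w U (𝓝 w₀) := hle
  have hcoord : ∀ c, Tendsto (fun δ => ENNReal.ofReal (w δ c)) U (𝓝 (ENNReal.ofReal (w₀ c))) :=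
    fun c => ENNReal.tendsto_ofReal ((continuous_apply c).tendsto w₀ |>.comp hlim)
  have hw₀p : w₀ ∈ clippedSimplex p := ⟨hw₀, fun c => by
    have h1 : Tendsto (fun δ => (A δ).selectionRate θ c) U (𝓝 (ENNReal.ofReal (w₀ c))) :=
      (hcoord c).congr' (by
        filter_upwards [hgood] with δ h
        exact ((hw δ h.1 h.2).2.1 c).symm)
    -- Passing to a finer filter can only raise the `liminf`, and along `U` it is the limit weight.
    have h2 := (hfair c).trans (liminf_le_liminf_of_le hU)
    rwa [h1.liminf_eq, ENNReal.ofReal_le_ofReal_iff (hw₀.1 c)] at h2⟩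
  refine hC2.not_ge (charTime_le hw₀p fun c hc => ?_)
  have hd : ENNReal.ofReal ((θ a - θ c) ^ 2) ≠ 0 := by
    simpa using sub_ne_zero.2 (ha c hc).ne'
  -- Inversion is continuous on all of `ℝ≥0∞`, so limit weights equal to zero need no separate
  -- treatment.
  have hX : Tendsto (fun δ => 2 * (((ENNReal.ofReal (w δ c))⁻¹ + (ENNReal.ofReal (w δ a))⁻¹) /
      ENNReal.ofReal ((θ a - θ c) ^ 2))) U
      (𝓝 (2 * (((ENNReal.ofReal (w₀ c))⁻¹ + (ENNReal.ofReal (w₀ a))⁻¹) /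
        ENNReal.ofReal ((θ a - θ c) ^ 2)))) :=
    ENNReal.Tendsto.const_mul (ENNReal.Tendsto.div_const
      (((hcoord c).inv).add ((hcoord a).inv)) (Or.inr hd)) (Or.inr (by simp))
  have hprod := ENNReal.Tendsto.mul hX (Or.inr ENNReal.one_ne_top)
    (tendsto_log_ratio.mono_left hU) (Or.inl one_ne_zero)
  rw [mul_one] at hprod
  refine le_of_tendsto hprod ?_
  filter_upwards [hgood, hUC] with δ h hδC
  have hlog : 0 < Real.log (1 / δ) := by
    refine Real.log_pos ?_
    rw [lt_div_iff₀ h.1.1]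
    linarith [h.1.2]
  refine le_trans ?_ hδC.le
  rw [ENNReal.le_div_iff_mul_le (Or.inl (by simpa using hlog)) (Or.inl ENNReal.ofReal_ne_top),
    mul_assoc, ← ENNReal.ofReal_mul' hlog.le]
  have e : (1 - Real.log 2.4 / Real.log (1 / δ)) * Real.log (1 / δ) =
      Real.log (1 / (2.4 * δ)) := by
    rw [sub_mul, div_mul_cancel₀ _ hlog.ne', one_mul,
      ← Real.log_div (one_div_ne_zero h.1.1.ne') (by norm_num), div_div, mul_comm δ]
  rw [e]
  exact (hw δ h.1 h.2).2.2 c hc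

end FairBAI

theorem theorem1 (K : ℕ) :
    (∀ (p : Fin K → ℝ), FairBAI.IsFairnessRate p →
      ∀ δ ∈ Set.Ioo (0 : ℝ) (1 / 2), ∀ A : FairBAI.BAIAlgorithm K, FairBAI.IsFairPAC p δ A →
        ∀ (θ : Fin K → ℝ) (astar : Fin K), FairBAI.IsUniqueBestArm θ astar →
          FairBAI.charTime θ astar p * ENNReal.ofReal (Real.log (1 / (2.4 * δ))) ≤
            A.sampleComplexity θ) ∧
    (∀ (p : (Fin K → ℝ) → Fin K → ℝ),
      (∀ (θ : Fin K → ℝ) (astar : Fin K), FairBAI.IsUniqueBestArm θ astar →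
        FairBAI.IsFairnessRate (p θ)) →
      ∀ A : ℝ → FairBAI.BAIAlgorithm K, FairBAI.IsAsympFairPAC p A →
        ∀ (θ : Fin K → ℝ) (astar : Fin K), FairBAI.IsUniqueBestArm θ astar →
          FairBAI.charTime θ astar (p θ) ≤
            liminf (fun δ => (A δ).sampleComplexity θ / ENNReal.ofReal (Real.log (1 / δ)))
              (𝓝[>] (0 : ℝ))) :=
  ⟨fun _ hp _ hδ _ hA _ _ ha => FairBAI.charTime_mul_log_le hp hδ hA ha,
    fun _ hp _ hA θ a ha =>
      FairBAI.charTime_le_liminf (hp θ a ha) hA.1 ha (hA.2 θ a ha)⟩
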